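/- For $a\ge 0$, $b>0$, $0<p<1$ and an integer $n\ge 0$, let $$\mathfrak C_n(a,b;p)=\frac{\sin(p\pi)}{\pi}\int_0^\infty\frac{t^p}{a^2+2a\cos(p\pi)\,t^p+t^{2p}}\,\frac{1}{(b+t)^{n+1}}\,dt$$ be the Catalan functional, and let $(x)_n=x(x+1)\cdots(x+n-1)$, $(x)_0=1$, be the rising factorial. The integral converges, and the following hold. (i) If $a>0$ and $|b^p/a|<1$, then $$\mathfrak C_n(a,b;p)=\frac{1}{a\,b^n\,n!}\sum_{k=0}^\infty(-pk)_n\Big(-\frac{b^p}{a}\Big)^{k},$$ and the series converges. (ii) If $a>0$ and $|b^p/a|>1$, then $$\mathfrak C_n(a,b;p)=-\frac{1}{a\,b^n\,n!}\sum_{k=1}^\infty(pk)_n\Big(-\frac{b^p}{a}\Big)^{-k},$$ and the series converges. If $n\ge1$, the summation may equally start at $k=0$, since $(0)_n=0$; if $n=0$, the term $k=0$ has to be omitted. For $a=0$ the formula holds after cancelling the factor $1/a$, that is, $\mathfrak C_n(0,b;p)=\dfrac{(p)_n}{n!\,b^{n+p}}$. (iii) If $a=b^p$, then $\mathfrak C_n(b^p,b;p)$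 is the limit of the right-hand side of (i), evaluated at $(a',b')$, as $(a',b')\to(b^p,b)$ within $\{a'>0,\ b'>0,\ |b'^p/a'|<1\}$, and also the limit of the right-hand side of (ii) (summed from $k=1$), evaluated at $(a',b')$, as $(a',b')\to(b^p,b)$ within $\{a'>0,\ b'>0,\ |b'^p/a'|>1\}$. (iv) For $n=0$ and all $a\ge 0$, $b>0$, $\mathfrak C_0(a,b;p)=\dfrac{1}{a+b^p}$; in particular $\mathfrak C_0(b^p,b;p)=\dfrac{1}{2b^p}$. -/

import Mathlib

open Filter Topology MeasureTheory

noncomputable section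

/-- The integrand `t^p / (a² + 2 a cos(pπ) t^p + t^{2p}) · (b + t)^{-(n+1)}`. -/
def catalanIntegrand (n : ℕ) (a b p t : ℝ) : ℝ :=
  t ^ p / (a ^ 2 + 2 * a * Real.cos (p * Real.pi) * t ^ p + t ^ (2 * p)) *
    (1 / (b + t) ^ (n + 1))

/-- The Catalan functional `𝔆_n(a,b;p)`. -/
def catalanFunctional (n : ℕ) (a b p : ℝ) : ℝ :=
  Real.sin (p * Real.pi) / Real.pi * ∫ t in Set.Ioi (0 : ℝ), catalanIntegrand n a b p t

/-- The rising factorial `(x)_n = x (x + 1) ⋯ (x + n - 1)`. -/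
def risingFactorial (x : ℝ) (n : ℕ) : ℝ := (ascPochhammer ℝ n).eval x

/-- The `k`-th term with the upper signs: `(-p k)_n (-b^p / a)^k`. -/
def upperTerm (n : ℕ) (a b p : ℝ) (k : ℕ) : ℝ :=
  risingFactorial (-(p * k)) n * (-(b ^ p / a)) ^ k

/-- The `k`-th term with the lower signs: `(p k)_n (-b^p / a)^{-k}`. -/
def lowerTerm (n : ℕ) (a b p : ℝ) (k : ℕ) : ℝ :=
  risingFactorial (p * k) n * (-(b ^ p / a)) ^ (-(k : ℤ))

end

/-!
In the logarithmic coordinate `w = log t` the integrand of `𝔆₀(a, b; p)` is, up to sign, the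
imaginary part on the line `Im w = π` of `f w * exp w / (exp w - b)` with
`f w = 1 / (a + exp (p w))`. Cauchy's theorem on the strip `0 ≤ Im w ≤ π` moves the integral to the
real line, where this function is real. The pole at `w = log b` is removed by subtracting from `f`
the multiple of `exp (-w / 2)` with the same value there, whose integral on the upper line is
elementary. This gives `𝔆₀(a, b; p) = 1 / (a + b ^ p)`.

Differentiating under the integral sign, `n! 𝔆ₙ` is `(-1) ^ n` times the `n`-th derivative of `𝔆₀`
in `b`, so both expansions come from differentiating termwise the geometric series of
`1 / (a + b ^ p)` in powers of `-b ^ p / a`, respectively of its inverse. At `a = b ^ p` both series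
have the right limit because `𝔆ₙ` is jointly continuous in `(a, b)`, by dominated convergence.
-/

theorem sin_mul_pi_pos {p : ℝ} (hp0 : 0 < p) (hp1 : p < 1) : 0 < Real.sin (p * Real.pi) :=
  Real.sin_pos_of_pos_of_lt_pi (by positivity) (mul_lt_of_lt_one_left Real.pi_pos hp1)

theorem sq_sin_mul_sq_le (a x θ : ℝ) :
    Real.sin θ ^ 2 * x ^ 2 ≤ a ^ 2 + 2 * a * Real.cos θ * x + x ^ 2 := by
  have hsq : a ^ 2 + 2 * a * Real.cos θ * x + x ^ 2 =
      Real.sin θ ^ 2 * x ^ 2 + (a + Real.cos θ * x) ^ 2 := by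
    linear_combination -x ^ 2 * Real.sin_sq_add_cos_sq θ
  exact hsq ▸ le_add_of_nonneg_right (sq_nonneg _)

theorem rpow_two_mul_eq_sq {t : ℝ} (ht : 0 ≤ t) (p : ℝ) : t ^ (2 * p) = (t ^ p) ^ 2 := by
  rw [mul_comm, Real.rpow_mul ht, Real.rpow_two]

theorem catalanDenom_pos {p : ℝ} (hp0 : 0 < p) (hp1 : p < 1) (a : ℝ) {t : ℝ} (ht : 0 < t) :
    0 < a ^ 2 + 2 * a * Real.cos (p * Real.pi) * t ^ p + t ^ (2 * p) := by
  have hsin := sin_mul_pi_pos hp0 hp1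
  rw [rpow_two_mul_eq_sq ht.le]
  exact lt_of_lt_of_le (by positivity) (sq_sin_mul_sq_le a (t ^ p) (p * Real.pi))

theorem catalanKernel_le {p : ℝ} (hp0 : 0 < p) (hp1 : p < 1) (a : ℝ) {t : ℝ} (ht : 0 < t) :
    t ^ p / (a ^ 2 + 2 * a * Real.cos (p * Real.pi) * t ^ p + t ^ (2 * p)) ≤
      1 / Real.sin (p * Real.pi) ^ 2 * t ^ (-p) := by
  have hsin := sin_mul_pi_pos hp0 hp1
  rw [div_le_iff₀ (catalanDenom_pos hp0 hp1 a ht), Real.rpow_neg ht.le, rpow_two_mul_eq_sq ht.le]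
  calc t ^ p = 1 / Real.sin (p * Real.pi) ^ 2 * (t ^ p)⁻¹ *
        (Real.sin (p * Real.pi) ^ 2 * (t ^ p) ^ 2) := by field_simp
    _ ≤ _ := by gcongr; exact sq_sin_mul_sq_le a (t ^ p) (p * Real.pi)

theorem norm_catalanIntegrand_le {p : ℝ} (hp0 : 0 < p) (hp1 : p < 1) (n : ℕ) (a : ℝ) {b c t : ℝ}
    (hc : 0 < c) (hcb : c ≤ b) (ht : 0 < t) :
    ‖catalanIntegrand n a b p t‖ ≤
      1 / Real.sin (p * Real.pi) ^ 2 * (t ^ (-p) * (1 / (c + t) ^ (n + 1))) := by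
  have hdenom := catalanDenom_pos hp0 hp1 a ht
  have hb : 0 < b := hc.trans_le hcb
  rw [Real.norm_of_nonneg (by unfold catalanIntegrand; positivity), catalanIntegrand, ← mul_assoc]
  gcongr
  exact catalanKernel_le hp0 hp1 a ht

theorem integrableOn_rpow_neg_mul_inv_pow {p : ℝ} (hp0 : 0 < p) (hp1 : p < 1) (n : ℕ) {b : ℝ}
    (hb : 0 < b) :
    IntegrableOn (fun t : ℝ ↦ t ^ (-p) * (1 / (b + t) ^ (n + 1))) (Set.Ioi 0) := by
  have hcont : ContinuousOn (fun t : ℝ ↦ 1 / (b + t) ^ (n + 1)) (Set.Ici 0) :=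
    continuousOn_const.div (by fun_prop) fun t (ht : 0 ≤ t) ↦ by positivity
  have htop : (fun t : ℝ ↦ 1 / (b + t) ^ (n + 1)) =O[atTop] (· ^ (-1 : ℝ)) := by
    refine .of_bound (1 / b ^ n) ?_
    filter_upwards [eventually_gt_atTop 0] with t ht
    rw [Real.norm_of_nonneg (by positivity), Real.norm_of_nonneg (by positivity),
      Real.rpow_neg_one, ← one_div, one_div_mul_one_div, pow_succ]
    gcongr <;> linarith
  have hzero : (fun t : ℝ ↦ 1 / (b + t) ^ (n + 1)) =O[𝓝[>] 0] (· ^ (-0 : ℝ)) := by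
    simpa using ((hcont 0 Set.self_mem_Ici).mono Set.Ioi_subset_Ici_self).isBigO_one ℝ
  have hmellin := mellin_convergent_of_isBigO_scalar (s := 1 - p)
    ((hcont.mono Set.Ioi_subset_Ici_self).locallyIntegrableOn measurableSet_Ioi)
    htop (by linarith) hzero (by linarith)
  rwa [sub_sub_cancel_left] at hmellin

theorem measurable_catalanIntegrand (n : ℕ) (a b p : ℝ) :
    Measurable (catalanIntegrand n a b p) := by
  unfold catalanIntegrand
  fun_prop

theorem integrableOn_catalanIntegrand {p : ℝ} (hp0 : 0 < p) (hp1 : p < 1) (n : ℕ) (a : ℝ) {b : ℝ}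
    (hb : 0 < b) : IntegrableOn (catalanIntegrand n a b p) (Set.Ioi 0) := by
  refine Integrable.mono' ((integrableOn_rpow_neg_mul_inv_pow hp0 hp1 n hb).const_mul
    (1 / Real.sin (p * Real.pi) ^ 2)) (measurable_catalanIntegrand n a b p).aestronglyMeasurable ?_
  filter_upwards [ae_restrict_mem measurableSet_Ioi] with t ht
  exact norm_catalanIntegrand_le hp0 hp1 n a hb le_rfl ht

theorem hasDerivAt_catalanIntegrand (n : ℕ) (a p : ℝ) {b t : ℝ} (hbt : b + t ≠ 0) :
    HasDerivAt (fun b ↦ catalanIntegrand n a b p t)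
      (-(n + 1) * catalanIntegrand (n + 1) a b p t) b := by
  have hpow : HasDerivAt (fun b ↦ 1 / (b + t) ^ (n + 1))
      (-(n + 1) * (1 / (b + t) ^ (n + 2))) b := by
    simp only [one_div]
    refine ((((hasDerivAt_id b).add_const t).pow (n + 1)).inv (pow_ne_zero _ hbt)).congr_deriv ?_
    push_cast [id, Pi.pow_apply]
    field_simp
    ring
  exact (hpow.const_mul _).congr_deriv (mul_left_comm _ _ _)

theorem hasDerivAt_catalanFunctional {p : ℝ} (hp0 : 0 < p) (hp1 : p < 1) (n : ℕ) (a : ℝ) {b : ℝ}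
    (hb : 0 < b) :
    HasDerivAt (fun b ↦ catalanFunctional n a b p)
      (-(n + 1) * catalanFunctional (n + 1) a b p) b := by
  have hderiv := (hasDerivAt_integral_of_dominated_loc_of_deriv_le
    (μ := volume.restrict (Set.Ioi (0 : ℝ))) (F := fun b t ↦ catalanIntegrand n a b p t)
    (F' := fun b t ↦ -(n + 1) * catalanIntegrand (n + 1) a b p t)
    (bound := fun t ↦ (n + 1) * (1 / Real.sin (p * Real.pi) ^ 2 *
      (t ^ (-p) * (1 / (b / 2 + t) ^ (n + 1 + 1)))))
    (Ioi_mem_nhds (half_lt_self hb))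
    (Eventually.of_forall fun b ↦ (measurable_catalanIntegrand n a b p).aestronglyMeasurable)
    (integrableOn_catalanIntegrand hp0 hp1 n a hb)
    ((measurable_catalanIntegrand (n + 1) a b p).const_mul _).aestronglyMeasurable
    ?_ (((integrableOn_rpow_neg_mul_inv_pow hp0 hp1 (n + 1) (half_pos hb)).const_mul _).const_mul _)
    ?_).2.const_mul (Real.sin (p * Real.pi) / Real.pi)
  · rwa [integral_const_mul, mul_left_comm] at hderiv
  · filter_upwards [ae_restrict_mem measurableSet_Ioi] with t ht x hx
    rw [norm_mul, norm_neg, Real.norm_of_nonneg (by positivity : (0 : ℝ) ≤ n + 1)]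
    gcongr
    exact norm_catalanIntegrand_le hp0 hp1 (n + 1) a (half_pos hb) (le_of_lt hx) ht
  · filter_upwards [ae_restrict_mem measurableSet_Ioi] with t ht x hx
    exact hasDerivAt_catalanIntegrand n a p (add_pos ((half_pos hb).trans hx) ht).ne'

theorem continuousAt_catalanFunctional {p : ℝ} (hp0 : 0 < p) (hp1 : p < 1) (n : ℕ) (a : ℝ) {b : ℝ}
    (hb : 0 < b) :
    ContinuousAt (fun q : ℝ × ℝ ↦ catalanFunctional n q.1 q.2 p) (a, b) := by
  refine continuousAt_const.mul (continuousAt_of_dominated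
    (bound := fun t ↦ 1 / Real.sin (p * Real.pi) ^ 2 *
      (t ^ (-p) * (1 / (b / 2 + t) ^ (n + 1))))
    (Eventually.of_forall fun q ↦ (measurable_catalanIntegrand n q.1 q.2 p).aestronglyMeasurable)
    ?_ ((integrableOn_rpow_neg_mul_inv_pow hp0 hp1 n (half_pos hb)).const_mul _) ?_)
  · filter_upwards [continuousAt_snd.eventually (Ioi_mem_nhds (half_lt_self hb))] with q hq
    filter_upwards [ae_restrict_mem measurableSet_Ioi] with t ht
    exact norm_catalanIntegrand_le hp0 hp1 n q.1 (half_pos hb) (le_of_lt hq) ht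
  · filter_upwards [ae_restrict_mem measurableSet_Ioi] with t (ht : 0 < t)
    unfold catalanIntegrand
    exact .mul (.div (by fun_prop) (by fun_prop) (catalanDenom_pos hp0 hp1 a ht).ne')
      (.div (by fun_prop) (by fun_prop) (by positivity))

section Strip

open Complex Set
open scoped Real

theorem tendsto_integral_vertical_zero {E : Type*} [NormedAddCommGroup E] [NormedSpace ℝ E]
    {F : Filter ℝ} {g : ℂ → E} {h : ℝ} (hh : 0 ≤ h)
    (hg : Tendsto g (comap re F ⊓ 𝓟 (im ⁻¹' Icc 0 h)) (𝓝 0)) :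
    Tendsto (fun x : ℝ ↦ ∫ y in (0 : ℝ)..h, g (x + y * I)) F (𝓝 0) := by
  rw [NormedAddGroup.tendsto_nhds_zero] at hg ⊢
  intro ε hε
  have hsmall := hg (ε / (h + 1)) (by positivity)
  rw [eventually_inf_principal, eventually_comap] at hsmall
  filter_upwards [hsmall] with x hx
  have hbound : ∀ y ∈ uIoc 0 h, ‖g (x + y * I)‖ ≤ ε / (h + 1) := fun y hy ↦ by
    rw [uIoc_of_le hh] at hy
    exact (hx _ (by simp) (by simpa using ⟨hy.1.le, hy.2⟩)).le
  calc ‖∫ y in (0 : ℝ)..h, g (x + y * I)‖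
      ≤ ε / (h + 1) * |h - 0| := intervalIntegral.norm_integral_le_of_norm_le_const hbound
    _ = ε * (h / (h + 1)) := by rw [sub_zero, abs_of_nonneg hh]; ring
    _ < ε := mul_lt_of_lt_one_right hε ((div_lt_one (by positivity)).2 (lt_add_one h))

theorem tendsto_integral_sub_integral_add_mul_I {E : Type*} [NormedAddCommGroup E]
    [NormedSpace ℂ E] {g : ℂ → E} {h : ℝ} (hh : 0 ≤ h)
    (hcont : ContinuousOn g (im ⁻¹' Icc 0 h)) (hdiff : DifferentiableOn ℂ g (im ⁻¹' Ioo 0 h))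
    (htop : Tendsto g (comap re atTop ⊓ 𝓟 (im ⁻¹' Icc 0 h)) (𝓝 0))
    (hbot : Tendsto g (comap re atBot ⊓ 𝓟 (im ⁻¹' Icc 0 h)) (𝓝 0)) :
    Tendsto (fun R : ℝ ↦ (∫ x in -R..R, g x) - ∫ x in -R..R, g (x + h * I)) atTop (𝓝 0) := by
  have hsides : Tendsto (fun R : ℝ ↦ I • (∫ y in (0 : ℝ)..h, g ((-R : ℝ) + y * I)) -
      I • ∫ y in (0 : ℝ)..h, g (R + y * I)) atTop (𝓝 0) := by
    simpa using (((tendsto_integral_vertical_zero hh hbot).comp tendsto_neg_atTop_atBot).const_smul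
      I).sub ((tendsto_integral_vertical_zero hh htop).const_smul I)
  refine hsides.congr fun R ↦ ?_
  have hrect := integral_boundary_rect_eq_zero_of_continuousOn_of_differentiableOn g (-R : ℝ)
    (R + h * I) (hcont.mono fun w hw ↦ ?_) (hdiff.mono fun w hw ↦ ?_)
  · simp only [ofReal_re, ofReal_im, add_re, add_im, mul_re, mul_im, I_re, I_im, mul_zero, mul_one,
      zero_mul, sub_zero, add_zero, zero_add, ofReal_zero] at hrect
    rw [sub_eq_iff_eq_add, ← sub_eq_zero, ← neg_eq_zero, ← hrect]
    abel
  · simpa [uIcc_of_le hh] using hw.2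
  · simpa [hh] using hw.2

theorem dslope_exp_ne_zero {c w : ℂ} (hw : |w.im - c.im| < 2 * π) : dslope exp c w ≠ 0 := by
  rcases eq_or_ne w c with rfl | hwc
  · simp
  rw [dslope_of_ne _ hwc, slope_def_field]
  refine div_ne_zero (sub_ne_zero.2 fun hexp ↦ hwc ?_) (sub_ne_zero.2 hwc)
  obtain ⟨n, hn⟩ := exp_eq_exp_iff_exists_int.1 hexp
  have him : w.im - c.im = n * (2 * π) := by simp [hn]
  have hn0 : n = 0 := by
    rw [him, abs_mul, abs_of_pos Real.two_pi_pos, mul_lt_iff_lt_one_left Real.two_pi_pos] at hw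
    exact Int.abs_lt_one_iff.1 (by exact_mod_cast hw)
  simpa [hn0] using hn

/-- The extension of `w ↦ (f w - f l) * exp w / (exp w - exp l)` over the removable singularity
`w = l`. For `f` vanishing at `l` this is the Cauchy kernel of the upper half-plane, read in the
logarithmic coordinate `w`, times `f`. -/
noncomputable def expCauchyQuotient (f : ℂ → ℂ) (l w : ℂ) : ℂ :=
  dslope f l w / dslope exp l w * exp w

theorem expCauchyQuotient_of_ne (f : ℂ → ℂ) {l w : ℂ} (hw : w ≠ l) :
    expCauchyQuotient f l w = (f w - f l) * (exp w / (exp w - exp l)) := by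
  rw [expCauchyQuotient, dslope_of_ne _ hw, dslope_of_ne _ hw, slope_def_field, slope_def_field,
    div_div_div_cancel_right₀ (sub_ne_zero.2 hw)]
  ring

theorem differentiableOn_expCauchyQuotient {f : ℂ → ℂ} {U : Set ℂ} {l : ℝ} (hU : IsOpen U)
    (hstrip : im ⁻¹' Icc 0 π ⊆ U) (hf : DifferentiableOn ℂ f U) :
    DifferentiableOn ℂ (expCauchyQuotient f l) (im ⁻¹' Icc 0 π) := by
  have hl : (l : ℂ) ∈ U := hstrip (by simp [Real.pi_pos.le])
  refine .mul (.div ?_ ?_ fun w hw ↦ dslope_exp_ne_zero ?_) differentiable_exp.differentiableOn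
  · exact ((differentiableOn_dslope (hU.mem_nhds hl)).2 hf).mono hstrip
  · exact ((differentiableOn_dslope univ_mem).2 differentiable_exp.differentiableOn).mono
      (subset_univ _)
  · rw [ofReal_im, sub_zero, abs_of_nonneg hw.1]
    exact hw.2.trans_lt (by linarith [Real.pi_pos])

theorem tendsto_exp_div_exp_sub_atTop (c : ℂ) :
    Tendsto (fun w ↦ exp w / (exp w - c)) (comap re atTop) (𝓝 1) := by
  have hinv : Tendsto (fun w ↦ (exp w)⁻¹) (comap re atTop) (𝓝 0) :=
    tendsto_inv₀_cobounded.comp tendsto_exp_comap_re_atTop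
  have hlim : Tendsto (fun w ↦ (1 - c * (exp w)⁻¹)⁻¹) (comap re atTop) (𝓝 (1 - c * 0)⁻¹) :=
    ((hinv.const_mul c).const_sub 1).inv₀ (by simp)
  rw [mul_zero, sub_zero, inv_one] at hlim
  refine hlim.congr fun w ↦ ?_
  rw [← div_eq_mul_inv, one_sub_div (exp_ne_zero w), inv_div]

theorem tendsto_expCauchyQuotient_atTop {f : ℂ → ℂ} {l : ℂ} {S : Set ℂ} (hl : f l = 0)
    (htop : Tendsto f (comap re atTop ⊓ 𝓟 S) (𝓝 0)) :
    Tendsto (expCauchyQuotient f l) (comap re atTop ⊓ 𝓟 S) (𝓝 0) := by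
  have hlim := htop.mul ((tendsto_exp_div_exp_sub_atTop (exp l)).mono_left inf_le_left)
  rw [zero_mul] at hlim
  have hne : ∀ᶠ w in comap re atTop ⊓ 𝓟 S, w ≠ l :=
    ((tendsto_comap.eventually (eventually_ne_atTop l.re)).filter_mono inf_le_left).mono
      fun w hw ↦ ne_of_apply_ne re hw
  refine hlim.congr' (hne.mono fun w hw ↦ ?_)
  rw [expCauchyQuotient_of_ne f hw, hl, sub_zero]

theorem tendsto_expCauchyQuotient_atBot {f : ℂ → ℂ} {l : ℂ} {S : Set ℂ} (hl : f l = 0)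
    (hbot : Tendsto (fun w ↦ f w * exp w) (comap re atBot ⊓ 𝓟 S) (𝓝 0)) :
    Tendsto (expCauchyQuotient f l) (comap re atBot ⊓ 𝓟 S) (𝓝 0) := by
  have hden : Tendsto (fun w ↦ exp w - exp l) (comap re atBot ⊓ 𝓟 S) (𝓝 (0 - exp l)) :=
    (tendsto_exp_comap_re_atBot.mono_left inf_le_left).sub_const _
  have hlim := hbot.div hden (by simp)
  rw [zero_div] at hlim
  have hne : ∀ᶠ w in comap re atBot ⊓ 𝓟 S, w ≠ l :=
    ((tendsto_comap.eventually (eventually_ne_atBot l.re)).filter_mono inf_le_left).mono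
      fun w hw ↦ ne_of_apply_ne re hw
  refine hlim.congr' (hne.mono fun w hw ↦ ?_)
  rw [Pi.div_apply, expCauchyQuotient_of_ne f hw, hl, sub_zero, mul_div_assoc]

theorem im_expCauchyQuotient_ofReal {f : ℂ → ℂ} {l x : ℝ} (hreal : ∀ x : ℝ, (f x).im = 0)
    (hx : x ≠ l) : (expCauchyQuotient f l x).im = 0 := by
  have hf (y : ℝ) : f y = ((f y).re : ℝ) := Complex.ext rfl (hreal y)
  rw [expCauchyQuotient_of_ne f (by exact_mod_cast hx), hf x, hf l]
  norm_cast

theorem im_expCauchyQuotient_add_pi_mul_I {f : ℂ → ℂ} {l : ℝ} (hl : f l = 0) (x : ℝ) :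
    (expCauchyQuotient f l (x + π * I)).im =
      (f (x + π * I)).im * (Real.exp x / (Real.exp x + Real.exp l)) := by
  have hne : (x + π * I : ℂ) ≠ l := ne_of_apply_ne im (by simp [Real.pi_ne_zero])
  have hkernel : exp (x + π * I) / (exp (x + π * I) - exp l) =
      ((Real.exp x / (Real.exp x + Real.exp l) : ℝ) : ℂ) := by
    rw [exp_add, exp_pi_mul_I, mul_neg_one, ← neg_add', neg_div_neg_eq]
    norm_cast
  rw [expCauchyQuotient_of_ne f hne, hl, sub_zero, hkernel, im_mul_ofReal]

theorem tendsto_integral_im_mul_of_eq_zero {f : ℂ → ℂ} {U : Set ℂ} {l : ℝ} (hU : IsOpen U)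
    (hstrip : im ⁻¹' Icc 0 π ⊆ U) (hf : DifferentiableOn ℂ f U) (hreal : ∀ x : ℝ, (f x).im = 0)
    (htop : Tendsto f (comap re atTop ⊓ 𝓟 (im ⁻¹' Icc 0 π)) (𝓝 0))
    (hbot : Tendsto (fun w ↦ f w * exp w) (comap re atBot ⊓ 𝓟 (im ⁻¹' Icc 0 π)) (𝓝 0))
    (hl : f l = 0) :
    Tendsto (fun R : ℝ ↦ ∫ x in -R..R,
      (f (x + π * I)).im * (Real.exp x / (Real.exp x + Real.exp l))) atTop (𝓝 0) := by
  have hdiff := differentiableOn_expCauchyQuotient (l := l) hU hstrip hf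
  have hint {y : ℝ} (hy : y ∈ Icc 0 π) (R : ℝ) :
      IntervalIntegrable (fun x : ℝ ↦ expCauchyQuotient f l (x + y * I)) volume (-R) R :=
    (hdiff.continuousOn.comp_continuous (by fun_prop) fun x ↦ by simpa using hy).intervalIntegrable
      _ _
  have hlim := ((continuous_im.tendsto _).comp <| tendsto_integral_sub_integral_add_mul_I
    Real.pi_pos.le hdiff.continuousOn (hdiff.mono (preimage_mono Ioo_subset_Icc_self))
    (tendsto_expCauchyQuotient_atTop hl htop) (tendsto_expCauchyQuotient_atBot hl hbot)).neg
  rw [zero_im, neg_zero] at hlim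
  refine hlim.congr fun R ↦ ?_
  have hbottom : (∫ x in -R..R, expCauchyQuotient f l x).im = 0 := by
    refine (imCLM.intervalIntegral_comp_comm
      (by simpa using hint ⟨le_rfl, Real.pi_pos.le⟩ R)).symm.trans
      (intervalIntegral.integral_zero_ae ?_)
    filter_upwards [Measure.ae_ne volume l] with x hx _ using im_expCauchyQuotient_ofReal hreal hx
  have htopside := imCLM.intervalIntegral_comp_comm (hint ⟨Real.pi_pos.le, le_rfl⟩ R)
  simp only [imCLM_apply, im_expCauchyQuotient_add_pi_mul_I hl] at htopside
  rw [Function.comp_apply, sub_im, hbottom, zero_sub, neg_neg, htopside]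

theorem continuous_exp_div_exp_add_exp (l : ℝ) :
    Continuous fun x ↦ Real.exp x / (Real.exp x + Real.exp l) :=
  Real.continuous_exp.div₀ (by fun_prop) fun x ↦ by positivity

theorem tendsto_integral_exp_half_mul_exp_div (l : ℝ) :
    Tendsto (fun R : ℝ ↦ ∫ x in -R..R,
      Real.exp ((l - x) / 2) * (Real.exp x / (Real.exp x + Real.exp l))) atTop (𝓝 π) := by
  have hderiv (x : ℝ) : HasDerivAt (fun x ↦ 2 * Real.arctan (Real.exp ((x - l) / 2)))
      (Real.exp ((l - x) / 2) * (Real.exp x / (Real.exp x + Real.exp l))) x := by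
    have hinner : HasDerivAt (fun x ↦ (x - l) / 2) (1 / 2) x :=
      ((hasDerivAt_id x).sub_const l).div_const 2
    refine (hinner.exp.arctan.const_mul 2).congr_deriv ?_
    have hx : Real.exp x = Real.exp l * Real.exp ((x - l) / 2) ^ 2 := by
      rw [← Real.exp_nat_mul, ← Real.exp_add]
      congr 1
      push_cast
      ring
    rw [← neg_sub x l, neg_div, Real.exp_neg, hx]
    field_simp
    ring
  have hFTC (R : ℝ) := intervalIntegral.integral_eq_sub_of_hasDerivAt (a := -R) (b := R)
    (fun x _ ↦ hderiv x) ((Continuous.mul (by fun_prop)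
      (continuous_exp_div_exp_add_exp l)).intervalIntegrable _ _)
  simp only [hFTC]
  have htop : Tendsto (fun R ↦ Real.arctan (Real.exp ((R - l) / 2))) atTop (𝓝 (π / 2)) :=
    (Real.tendsto_arctan_atTop.mono_right nhdsWithin_le_nhds).comp <| Real.tendsto_exp_atTop.comp <|
      (tendsto_atTop_add_const_right _ (-l) tendsto_id).atTop_div_const two_pos
  have hbot : Tendsto (fun R ↦ Real.arctan (Real.exp ((-R - l) / 2))) atTop (𝓝 0) := by
    have := (Real.continuous_arctan.tendsto 0).comp <| Real.tendsto_exp_atBot.comp <|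
      (tendsto_atBot_add_const_right _ (-l) tendsto_neg_atTop_atBot).atBot_div_const two_pos
    rwa [Real.arctan_zero] at this
  convert (htop.const_mul 2).sub (hbot.const_mul 2) using 2
  ring

theorem tendsto_ofReal_mul_comap_re_atTop {c : ℝ} (hc : 0 < c) :
    Tendsto (fun w : ℂ ↦ c * w) (comap re atTop) (comap re atTop) :=
  tendsto_comap_iff.2 <| (tendsto_comap.const_mul_atTop hc).congr fun w ↦ (re_ofReal_mul c w).symm

theorem tendsto_ofReal_mul_comap_re_atBot {c : ℝ} (hc : 0 < c) :
    Tendsto (fun w : ℂ ↦ c * w) (comap re atBot) (comap re atBot) :=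
  tendsto_comap_iff.2 <| (tendsto_comap.const_mul_atBot hc).congr fun w ↦ (re_ofReal_mul c w).symm

theorem tendsto_exp_half_sub_atTop (l : ℂ) :
    Tendsto (fun w ↦ exp ((l - w) / 2)) (comap re atTop) (𝓝 0) := by
  have hlim := (tendsto_inv₀_cobounded.comp <| tendsto_exp_comap_re_atTop.comp <|
    tendsto_ofReal_mul_comap_re_atTop one_half_pos).const_mul (exp (l / 2))
  rw [mul_zero] at hlim
  refine hlim.congr fun w ↦ ?_
  simp only [Function.comp_apply, ← exp_neg, ← exp_add]
  push_cast
  ring_nf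

theorem tendsto_exp_half_sub_mul_exp_atBot (l : ℂ) :
    Tendsto (fun w ↦ exp ((l - w) / 2) * exp w) (comap re atBot) (𝓝 0) := by
  have hlim := (tendsto_exp_comap_re_atBot.comp <|
    tendsto_ofReal_mul_comap_re_atBot one_half_pos).const_mul (exp (l / 2))
  rw [mul_zero] at hlim
  refine hlim.congr fun w ↦ ?_
  simp only [Function.comp_apply, ← exp_add]
  push_cast
  ring_nf

theorem exp_half_sub_add_pi_mul_I (l x : ℂ) :
    exp ((l - (x + π * I)) / 2) = -I * exp ((l - x) / 2) := by
  rw [← exp_neg_pi_div_two_mul_I, ← exp_add]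
  ring_nf

theorem tendsto_integral_im_mul_exp_div {f : ℂ → ℂ} {U : Set ℂ} (hU : IsOpen U)
    (hstrip : im ⁻¹' Icc 0 π ⊆ U) (hf : DifferentiableOn ℂ f U) (hreal : ∀ x : ℝ, (f x).im = 0)
    (htop : Tendsto f (comap re atTop ⊓ 𝓟 (im ⁻¹' Icc 0 π)) (𝓝 0))
    (hbot : Tendsto (fun w ↦ f w * exp w) (comap re atBot ⊓ 𝓟 (im ⁻¹' Icc 0 π)) (𝓝 0)) (l : ℝ) :
    Tendsto (fun R : ℝ ↦ ∫ x in -R..R,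
      (f (x + π * I)).im * (Real.exp x / (Real.exp x + Real.exp l)))
      atTop (𝓝 (-(π * (f l).re))) := by
  obtain ⟨c, hc⟩ : ∃ c : ℝ, f l = c := ⟨(f l).re, Complex.ext rfl (hreal l)⟩
  have hexp (x : ℝ) : exp ((l - x) / 2) = (Real.exp ((l - x) / 2) : ℝ) := by push_cast; rfl
  set g : ℂ → ℂ := fun w ↦ f w - c * exp ((l - w) / 2) with hg
  have him (x : ℝ) : (g (x + π * I)).im =
      (f (x + π * I)).im + c * Real.exp ((l - x) / 2) := by
    simp only [hg, exp_half_sub_add_pi_mul_I, hexp, sub_im, im_ofReal_mul, im_mul_ofReal, neg_im,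
      I_im]
    ring
  have hzero : Tendsto (fun R : ℝ ↦ ∫ x in -R..R,
      (g (x + π * I)).im * (Real.exp x / (Real.exp x + Real.exp l))) atTop (𝓝 0) := by
    refine tendsto_integral_im_mul_of_eq_zero hU hstrip (hf.sub (by fun_prop)) (fun x ↦ ?_) ?_ ?_ ?_
    · rw [hg, sub_im, hreal, im_ofReal_mul, hexp, ofReal_im, mul_zero, sub_zero]
    · simpa using htop.sub
        (((tendsto_exp_half_sub_atTop l).mono_left inf_le_left).const_mul (c : ℂ))
    · simpa [hg, sub_mul, mul_assoc] using hbot.sub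
        (((tendsto_exp_half_sub_mul_exp_atBot l).mono_left inf_le_left).const_mul (c : ℂ))
    · simp [hg, hc]
  have hlim := hzero.sub ((tendsto_integral_exp_half_mul_exp_div l).const_mul c)
  rw [zero_sub] at hlim
  rw [hc, ofReal_re, mul_comm π]
  refine hlim.congr fun R ↦ ?_
  have hfcont : Continuous fun x : ℝ ↦ (f (x + π * I)).im :=
    continuous_im.comp <| hf.continuousOn.comp_continuous (by fun_prop) fun x ↦
      hstrip (by simp [Real.pi_pos.le])
  have hK := continuous_exp_div_exp_add_exp l
  rw [← intervalIntegral.integral_const_mul, ← intervalIntegral.integral_sub]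
  · refine intervalIntegral.integral_congr fun x _ ↦ ?_
    simp only [him]
    ring
  · simp only [him]
    exact (Continuous.mul (hfcont.add (by fun_prop)) hK).intervalIntegrable _ _
  · exact (continuous_const.mul (Continuous.mul (by fun_prop) hK)).intervalIntegrable _ _

end Strip

section StieltjesRepresentation

open Complex Set
open scoped Real

theorem tendsto_integral_exp_smul_comp_exp {E : Type*} [NormedAddCommGroup E] [NormedSpace ℝ E]
    {g : ℝ → E} (hg : IntegrableOn g (Ioi 0)) :
    Tendsto (fun R : ℝ ↦ ∫ x in -R..R, Real.exp x • g (Real.exp x)) atTop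
      (𝓝 (∫ t in Ioi 0, g t)) := by
  have himage : Real.exp '' univ = Ioi 0 := by rw [image_univ, Real.range_exp]
  have hderiv : ∀ x ∈ univ, HasDerivWithinAt Real.exp (Real.exp x) univ x :=
    fun x _ ↦ (Real.hasDerivAt_exp x).hasDerivWithinAt
  have hint : Integrable fun x ↦ Real.exp x • g (Real.exp x) := by
    rw [← himage, integrableOn_image_iff_integrableOn_abs_deriv_smul .univ hderiv
      Real.exp_injective.injOn] at hg
    simpa only [Real.abs_exp, integrableOn_univ] using hg
  have hchange := integral_image_eq_integral_abs_deriv_smul .univ hderiv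
    Real.exp_injective.injOn g
  simp only [himage, Real.abs_exp, setIntegral_univ] at hchange
  exact hchange ▸ intervalIntegral_tendsto_integral hint tendsto_neg_atTop_atBot tendsto_id

theorem ofReal_add_exp_ne_zero {a : ℝ} (ha : 0 ≤ a) {z : ℂ} (hz : |z.im| < π) :
    (a : ℂ) + exp z ≠ 0 := by
  intro hzero
  have him : z.im = 0 := by
    have hsin : Real.exp z.re * Real.sin z.im = 0 := by simpa [exp_im] using congrArg im hzero
    exact (Real.sin_eq_zero_iff_of_lt_of_lt (abs_lt.1 hz).1 (abs_lt.1 hz).2).1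
      ((mul_eq_zero.1 hsin).resolve_left (Real.exp_ne_zero _))
  have hre : a + Real.exp z.re = 0 := by simpa [exp_re, him] using congrArg re hzero
  exact (add_pos_of_nonneg_of_pos ha (Real.exp_pos _)).ne' hre

theorem im_inv_ofReal_add_exp (a : ℝ) (z : ℂ) :
    ((a + exp z)⁻¹).im = -(Real.sin z.im * Real.exp z.re) /
      (a ^ 2 + 2 * a * Real.cos z.im * Real.exp z.re + Real.exp z.re ^ 2) := by
  rw [inv_im, normSq_apply]
  simp only [add_re, add_im, ofReal_re, ofReal_im, exp_re, exp_im, zero_add]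
  congr 1
  · ring
  · linear_combination Real.exp z.re ^ 2 * Real.sin_sq_add_cos_sq z.im

theorem tendsto_inv_add_exp_atTop {p : ℝ} (hp0 : 0 < p) (a : ℂ) :
    Tendsto (fun w : ℂ ↦ (a + exp (p * w))⁻¹) (comap re atTop) (𝓝 0) :=
  tendsto_inv₀_cobounded.comp <| (tendsto_const_add_cobounded a).comp <|
    tendsto_exp_comap_re_atTop.comp <| tendsto_ofReal_mul_comap_re_atTop hp0

theorem tendsto_inv_add_exp_mul_exp_atBot {p : ℝ} (hp0 : 0 < p) (hp1 : p < 1) (a : ℂ) :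
    Tendsto (fun w : ℂ ↦ (a + exp (p * w))⁻¹ * exp w) (comap re atBot) (𝓝 0) := by
  rcases eq_or_ne a 0 with rfl | ha
  · refine (tendsto_exp_comap_re_atBot.comp
      (tendsto_ofReal_mul_comap_re_atBot (sub_pos.2 hp1))).congr fun w ↦ ?_
    rw [Function.comp_apply, zero_add, ← exp_neg, ← exp_add]
    push_cast
    ring_nf
  · have hden : Tendsto (fun w : ℂ ↦ a + exp (p * w)) (comap re atBot) (𝓝 (a + 0)) :=
      (tendsto_exp_comap_re_atBot.comp (tendsto_ofReal_mul_comap_re_atBot hp0)).const_add a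
    simpa using (hden.inv₀ (by simpa using ha)).mul tendsto_exp_comap_re_atBot

theorem im_inv_add_exp_mul_exp_div (a p l x : ℝ) :
    ((a + exp (p * (x + π * I)))⁻¹).im * (Real.exp x / (Real.exp x + Real.exp l)) =
      -Real.sin (p * π) * (Real.exp x • catalanIntegrand 0 a (Real.exp l) p (Real.exp x)) := by
  have hre : (p * (x + π * I) : ℂ).re = x * p := by simp [mul_comm]
  have him : (p * (x + π * I) : ℂ).im = p * π := by simp
  rw [im_inv_ofReal_add_exp, hre, him, catalanIntegrand, rpow_two_mul_eq_sq (Real.exp_pos x).le,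
    Real.exp_mul, smul_eq_mul, add_comm (Real.exp l)]
  ring

theorem catalanFunctional_zero {p : ℝ} (hp0 : 0 < p) (hp1 : p < 1) {a b : ℝ} (ha : 0 ≤ a)
    (hb : 0 < b) : catalanFunctional 0 a b p = 1 / (a + b ^ p) := by
  obtain ⟨l, rfl⟩ : ∃ l, Real.exp l = b := ⟨Real.log b, Real.exp_log hb⟩
  have hreal (x : ℝ) : (a + exp (p * x))⁻¹ = ((a + Real.exp (p * x))⁻¹ : ℝ) := by push_cast; rfl
  have hopen : IsOpen {w : ℂ | |(p * w).im| < π} := isOpen_lt (by fun_prop) continuous_const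
  have hstrip : im ⁻¹' Icc 0 π ⊆ {w : ℂ | |(p * w).im| < π} := fun w hw ↦ by
    rw [mem_ofPred_eq, im_ofReal_mul, abs_of_nonneg (mul_nonneg hp0.le hw.1)]
    exact (mul_le_mul_of_nonneg_left hw.2 hp0.le).trans_lt (mul_lt_of_lt_one_left Real.pi_pos hp1)
  have hcauchy := tendsto_integral_im_mul_exp_div (f := fun w ↦ (a + exp (p * w))⁻¹) hopen hstrip
    (.inv (by fun_prop) fun w hw ↦ ofReal_add_exp_ne_zero ha hw)
    (fun x ↦ by rw [hreal, ofReal_im])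
    ((tendsto_inv_add_exp_atTop hp0 a).mono_left inf_le_left)
    ((tendsto_inv_add_exp_mul_exp_atBot hp0 hp1 a).mono_left inf_le_left) l
  have hsubst := (tendsto_integral_exp_smul_comp_exp
    (integrableOn_catalanIntegrand hp0 hp1 0 a hb)).const_mul (-Real.sin (p * π))
  simp only [im_inv_add_exp_mul_exp_div, intervalIntegral.integral_const_mul] at hcauchy
  have heq := tendsto_nhds_unique hsubst hcauchy
  rw [hreal, ofReal_re, neg_mul, neg_inj] at heq
  rw [catalanFunctional, div_mul_eq_mul_div, heq, mul_div_cancel_left₀ _ Real.pi_ne_zero,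
    ← Real.exp_mul, mul_comm p, one_div]

end StieltjesRepresentation

theorem eqOn_of_hasDerivAt_neg_succ {𝕜 E : Type*} [NontriviallyNormedField 𝕜]
    [NormedAddCommGroup E] [NormedSpace 𝕜 E] {F G : ℕ → 𝕜 → E} {U : Set 𝕜} (hU : IsOpen U)
    (hF : ∀ n, ∀ b ∈ U, HasDerivAt (F n) (-F (n + 1) b) b)
    (hG : ∀ n, ∀ b ∈ U, HasDerivAt (G n) (-G (n + 1) b) b) (hzero : Set.EqOn (F 0) (G 0) U)
    (n : ℕ) : Set.EqOn (F n) (G n) U := by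
  induction n with
  | zero => exact hzero
  | succ n ih =>
    intro b hb
    exact neg_injective <| ((hF n b hb).congr_of_eventuallyEq
      (ih.symm.eventuallyEq_of_mem (hU.mem_nhds hb))).unique (hG n b hb)

theorem hasDerivAt_factorial_mul_catalanFunctional {p : ℝ} (hp0 : 0 < p) (hp1 : p < 1) (n : ℕ)
    (a : ℝ) {b : ℝ} (hb : 0 < b) :
    HasDerivAt (fun b ↦ n.factorial * catalanFunctional n a b p)
      (-((n + 1).factorial * catalanFunctional (n + 1) a b p)) b := by
  refine ((hasDerivAt_catalanFunctional hp0 hp1 n a hb).const_mul _).congr_deriv ?_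
  rw [Nat.factorial_succ]
  push_cast
  ring

theorem summable_eval_mul_geometric {R : Type*} [NormedCommRing R] [HasSummableGeomSeries R]
    (P : Polynomial R) {r : R} (hr : ‖r‖ < 1) : Summable fun k : ℕ ↦ P.eval (k : R) * r ^ k := by
  simp only [Polynomial.eval_eq_sum_range, Finset.sum_mul, mul_assoc]
  exact summable_sum fun i _ ↦ (summable_pow_mul_geometric_of_norm_lt_one i hr).mul_left _

theorem risingFactorial_zero (x : ℝ) : risingFactorial x 0 = 1 := by simp [risingFactorial]

theorem risingFactorial_succ (x : ℝ) (n : ℕ) :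
    risingFactorial x (n + 1) = risingFactorial x n * (x + n) :=
  ascPochhammer_succ_eval n x

theorem risingFactorial_zero_left {n : ℕ} (hn : n ≠ 0) : risingFactorial 0 n = 0 :=
  ascPochhammer_ne_zero_eval_zero ℝ hn

theorem summable_risingFactorial_mul_geometric (q s : ℝ) (n : ℕ) {r : ℝ} (hr : |r| < 1) :
    Summable fun k : ℕ ↦ risingFactorial (-(q * k + s)) n * r ^ k := by
  simpa [risingFactorial] using summable_eval_mul_geometric
    ((ascPochhammer ℝ n).comp (-(.C q * .X + .C s))) hr

/-- `(-1) ^ n` times the `n`-th derivative in `b` of `y ^ k * b ^ (q * k + s)`, the `k`-th term of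
the geometric expansion of `b ^ s / (1 - y * b ^ q)`. -/
noncomputable def rpowTerm (q s y : ℝ) (n k : ℕ) (b : ℝ) : ℝ :=
  risingFactorial (-(q * k + s)) n * (y ^ k * b ^ (q * k + s - n))

theorem rpowTerm_eq_mul_pow (q s y : ℝ) (n k : ℕ) {b : ℝ} (hb : 0 < b) :
    rpowTerm q s y n k b = risingFactorial (-(q * k + s)) n * (y * b ^ q) ^ k * b ^ (s - n) := by
  rw [rpowTerm, add_sub_assoc, Real.rpow_add hb, Real.rpow_mul_natCast hb.le, mul_pow]
  ring

theorem summable_rpowTerm (q s : ℝ) {y : ℝ} (n : ℕ) {b : ℝ} (hb : 0 < b) (hy : |y * b ^ q| < 1) :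
    Summable fun k ↦ rpowTerm q s y n k b := by
  simp only [rpowTerm_eq_mul_pow q s y n _ hb]
  exact (summable_risingFactorial_mul_geometric q s n hy).mul_right _

theorem tsum_rpowTerm_zero (q s : ℝ) {y b : ℝ} (hb : 0 < b) (hy : |y * b ^ q| < 1) :
    ∑' k, rpowTerm q s y 0 k b = b ^ s / (1 - y * b ^ q) := by
  simp only [rpowTerm_eq_mul_pow q s y 0 _ hb, risingFactorial_zero, one_mul, Nat.cast_zero,
    sub_zero]
  rw [tsum_mul_right, tsum_geometric_of_abs_lt_one hy, inv_mul_eq_div]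

theorem hasDerivAt_rpowTerm (q s y : ℝ) (n k : ℕ) {b : ℝ} (hb : b ≠ 0) :
    HasDerivAt (rpowTerm q s y n k) (-rpowTerm q s y (n + 1) k b) b := by
  refine (((Real.hasDerivAt_rpow_const (.inl hb)).const_mul _).const_mul _).congr_deriv ?_
  rw [rpowTerm, risingFactorial_succ, Nat.cast_succ, ← sub_sub]
  ring

theorem continuousAt_mul_rpow (q y : ℝ) {b : ℝ} (hb : b ≠ 0) :
    ContinuousAt (fun x ↦ y * x ^ q) b :=
  (Real.continuousAt_rpow_const b q (.inl hb)).const_mul y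

theorem isOpen_setOf_abs_mul_rpow_lt_one (q y : ℝ) :
    IsOpen {b : ℝ | 0 < b ∧ |y * b ^ q| < 1} :=
  isOpen_iff_eventually.2 fun _ ⟨hb, hy⟩ ↦ (eventually_gt_nhds hb).and
    ((continuousAt_mul_rpow q y hb.ne').abs.eventually_lt_const hy)

theorem hasDerivAt_tsum_rpowTerm (q s : ℝ) {y : ℝ} (n : ℕ) {b : ℝ} (hb : 0 < b)
    (hy : |y * b ^ q| < 1) :
    HasDerivAt (fun b ↦ ∑' k, rpowTerm q s y n k b) (-∑' k, rpowTerm q s y (n + 1) k b) b := by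
  obtain ⟨r, hyr, hr⟩ := exists_between hy
  obtain ⟨M, hM⟩ := exists_gt (b ^ (s - (n + 1 : ℕ)))
  have hr0 : 0 ≤ r := (abs_nonneg _).trans hyr.le
  have hnear : ∀ᶠ x in 𝓝 b, 0 < x ∧ |y * x ^ q| < r ∧ x ^ (s - (n + 1 : ℕ)) < M :=
    (eventually_gt_nhds hb).and <|
      ((continuousAt_mul_rpow q y hb.ne').abs.eventually_lt_const hyr).and
        ((Real.continuousAt_rpow_const b _ (.inl hb.ne')).eventually_lt_const hM)
  obtain ⟨ε, hε, hball⟩ := Metric.eventually_nhds_iff_ball.1 hnear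
  have hsum := (summable_risingFactorial_mul_geometric q s (n + 1)
    ((abs_of_nonneg hr0).trans_lt hr)).norm.mul_right M
  rw [← tsum_neg]
  refine hasDerivAt_tsum_of_isPreconnected hsum Metric.isOpen_ball (convex_ball b ε).isPreconnected
    (fun k x hx ↦ hasDerivAt_rpowTerm q s y n k (hball x hx).1.ne') (fun k x hx ↦ ?_)
    (Metric.mem_ball_self hε) (summable_rpowTerm q s n hb hy) (Metric.mem_ball_self hε)
  obtain ⟨hx0, hxr, hxM⟩ := hball x hx
  rw [norm_neg, rpowTerm_eq_mul_pow q s y _ k hx0, norm_mul, norm_mul, norm_mul, norm_pow,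
    norm_pow, Real.norm_of_nonneg hr0, Real.norm_of_nonneg (Real.rpow_nonneg hx0.le _)]
  gcongr
  exact hxr.le

theorem factorial_mul_catalanFunctional_eq_tsum {p : ℝ} (hp0 : 0 < p) (hp1 : p < 1)
    {a q s y c : ℝ}
    (hzero : ∀ b, 0 < b → |y * b ^ q| < 1 →
      catalanFunctional 0 a b p = c * (b ^ s / (1 - y * b ^ q)))
    (n : ℕ) {b : ℝ} (hb : 0 < b) (hy : |y * b ^ q| < 1) :
    n.factorial * catalanFunctional n a b p = c * ∑' k, rpowTerm q s y n k b := by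
  refine eqOn_of_hasDerivAt_neg_succ (U := {b : ℝ | 0 < b ∧ |y * b ^ q| < 1})
    (F := fun n b ↦ n.factorial * catalanFunctional n a b p)
    (G := fun n b ↦ c * ∑' k, rpowTerm q s y n k b) (isOpen_setOf_abs_mul_rpow_lt_one q y)
    (fun n _ h ↦ hasDerivAt_factorial_mul_catalanFunctional hp0 hp1 n a h.1)
    (fun n _ h ↦ ?_) (fun b h ↦ ?_) n ⟨hb, hy⟩
  · simpa only [mul_neg] using (hasDerivAt_tsum_rpowTerm q s n h.1 h.2).const_mul c
  · simp only [Nat.factorial_zero, Nat.cast_one, one_mul, hzero b h.1 h.2,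
      tsum_rpowTerm_zero q s h.1 h.2]

theorem factorial_mul_catalanFunctional_eq_tsum_upper {p : ℝ} (hp0 : 0 < p) (hp1 : p < 1) (n : ℕ)
    {a b : ℝ} (ha : 0 < a) (hb : 0 < b) (hab : |-(1 / a) * b ^ p| < 1) :
    n.factorial * catalanFunctional n a b p = 1 / a * ∑' k, rpowTerm p 0 (-(1 / a)) n k b := by
  refine factorial_mul_catalanFunctional_eq_tsum hp0 hp1 (fun x hx _ ↦ ?_) n hb hab
  rw [catalanFunctional_zero hp0 hp1 ha.le hx, Real.rpow_zero, neg_mul, sub_neg_eq_add]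
  field_simp

theorem factorial_mul_catalanFunctional_eq_tsum_lower {p : ℝ} (hp0 : 0 < p) (hp1 : p < 1) (n : ℕ)
    {a b : ℝ} (ha : 0 ≤ a) (hb : 0 < b) (hab : |-a * b ^ (-p)| < 1) :
    n.factorial * catalanFunctional n a b p = ∑' k, rpowTerm (-p) (-p) (-a) n k b := by
  rw [← one_mul (∑' k, _)]
  refine factorial_mul_catalanFunctional_eq_tsum hp0 hp1 (fun x hx _ ↦ ?_) n hb hab
  rw [catalanFunctional_zero hp0 hp1 ha hx, Real.rpow_neg hx.le, neg_mul, sub_neg_eq_add]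
  field_simp
  ring

theorem rpowTerm_eq_upperTerm (n : ℕ) (a p : ℝ) (k : ℕ) {b : ℝ} (hb : 0 < b) :
    rpowTerm p 0 (-(1 / a)) n k b = (b ^ n)⁻¹ * upperTerm n a b p k := by
  rw [rpowTerm_eq_mul_pow _ _ _ _ _ hb, upperTerm, add_zero, zero_sub, Real.rpow_neg hb.le,
    Real.rpow_natCast, mul_comm (b ^ n)⁻¹]
  ring_nf

theorem rpowTerm_eq_lowerTerm_add_one (n : ℕ) {a : ℝ} (ha : a ≠ 0) (p : ℝ) (k : ℕ) {b : ℝ}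
    (hb : 0 < b) :
    rpowTerm (-p) (-p) (-a) n k b = -(a * b ^ n)⁻¹ * lowerTerm n a b p (k + 1) := by
  have hbase : -a * b ^ (-p) = (-(b ^ p / a))⁻¹ := by
    rw [Real.rpow_neg hb.le, inv_neg, inv_div, neg_mul, div_eq_mul_inv]
  have harg : -(-p * k + -p) = p * (k + 1 : ℕ) := by push_cast; ring
  rw [rpowTerm_eq_mul_pow _ _ _ _ _ hb, lowerTerm, harg, hbase, zpow_neg, zpow_natCast, pow_succ,
    inv_pow, Real.rpow_sub hb, Real.rpow_neg hb.le, Real.rpow_natCast]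
  field_simp

theorem summable_upperTerm (n : ℕ) {a b p : ℝ} (hab : |b ^ p / a| < 1) :
    Summable (upperTerm n a b p) := by
  refine (summable_risingFactorial_mul_geometric p 0 n ((abs_neg _).trans_lt hab)).congr fun k ↦ ?_
  rw [upperTerm, add_zero]

theorem catalanFunctional_eq_tsum_upperTerm {p : ℝ} (hp0 : 0 < p) (hp1 : p < 1) (n : ℕ) {a b : ℝ}
    (ha : 0 < a) (hb : 0 < b) (hab : |b ^ p / a| < 1) :
    catalanFunctional n a b p =
      1 / (a * b ^ n * n.factorial) * ∑' k, upperTerm n a b p k := by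
  have htsum := factorial_mul_catalanFunctional_eq_tsum_upper hp0 hp1 n ha hb
    (by rwa [neg_mul, abs_neg, one_div_mul_eq_div])
  simp only [rpowTerm_eq_upperTerm n a p _ hb, tsum_mul_left] at htsum
  rw [← mul_right_inj' (Nat.cast_ne_zero.2 n.factorial_ne_zero), htsum]
  field_simp

theorem summable_lowerTerm (n : ℕ) {a b p : ℝ} (hab : 1 < |b ^ p / a|) :
    Summable (lowerTerm n a b p) := by
  have hinv : |(-(b ^ p / a))⁻¹| < 1 := by
    rw [abs_inv, abs_neg]
    exact inv_lt_one_of_one_lt₀ hab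
  refine (summable_risingFactorial_mul_geometric (-p) 0 n hinv).congr fun k ↦ ?_
  rw [lowerTerm, zpow_neg, zpow_natCast, inv_pow, add_zero, neg_mul, neg_neg]

theorem catalanFunctional_eq_tsum_lowerTerm_add_one {p : ℝ} (hp0 : 0 < p) (hp1 : p < 1) (n : ℕ)
    {a b : ℝ} (ha : 0 < a) (hb : 0 < b) (hab : 1 < |b ^ p / a|) :
    catalanFunctional n a b p =
      -(1 / (a * b ^ n * n.factorial)) * ∑' k, lowerTerm n a b p (k + 1) := by
  have hab' : |-a * b ^ (-p)| < 1 := by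
    rw [Real.rpow_neg hb.le, neg_mul, abs_neg, ← div_eq_mul_inv, ← inv_div, abs_inv]
    exact inv_lt_one_of_one_lt₀ hab
  have htsum := factorial_mul_catalanFunctional_eq_tsum_lower hp0 hp1 n ha.le hb hab'
  simp only [rpowTerm_eq_lowerTerm_add_one n ha.ne' p _ hb, tsum_mul_left] at htsum
  rw [← mul_right_inj' (Nat.cast_ne_zero.2 n.factorial_ne_zero), htsum]
  field_simp

theorem lowerTerm_zero {n : ℕ} (hn : n ≠ 0) (a b p : ℝ) : lowerTerm n a b p 0 = 0 := by
  rw [lowerTerm, Nat.cast_zero, mul_zero, risingFactorial_zero_left hn, zero_mul]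

theorem catalanFunctional_eq_tsum_lowerTerm {p : ℝ} (hp0 : 0 < p) (hp1 : p < 1) {n : ℕ}
    (hn : n ≠ 0) {a b : ℝ} (ha : 0 < a) (hb : 0 < b) (hab : 1 < |b ^ p / a|) :
    catalanFunctional n a b p =
      -(1 / (a * b ^ n * n.factorial)) * ∑' k, lowerTerm n a b p k := by
  rw [(summable_lowerTerm n hab).tsum_eq_zero_add, lowerTerm_zero hn, zero_add]
  exact catalanFunctional_eq_tsum_lowerTerm_add_one hp0 hp1 n ha hb hab

theorem catalanFunctional_zero_eq_risingFactorial_div {p : ℝ} (hp0 : 0 < p) (hp1 : p < 1) (n : ℕ)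
    {b : ℝ} (hb : 0 < b) :
    catalanFunctional n 0 b p = risingFactorial p n / (n.factorial * b ^ (n + p)) := by
  have htsum := factorial_mul_catalanFunctional_eq_tsum_lower hp0 hp1 n le_rfl hb (by simp)
  rw [tsum_eq_single 0 fun k hk ↦ by simp [rpowTerm, hk]] at htsum
  rw [← mul_right_inj' (Nat.cast_ne_zero.2 n.factorial_ne_zero), htsum, rpowTerm, add_comm (n : ℝ),
    Nat.cast_zero, mul_zero, zero_add, neg_neg, pow_zero, one_mul, ← neg_add', Real.rpow_neg hb.le]
  field_simp

theorem mainTheorem2 (p : ℝ) (hp0 : 0 < p) (hp1 : p < 1) (n : ℕ) :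
    -- the defining integral converges
    (∀ a b : ℝ, 0 ≤ a → 0 < b →
      IntegrableOn (catalanIntegrand n a b p) (Set.Ioi 0)) ∧
    -- upper signs
    (∀ a b : ℝ, 0 < a → 0 < b → |b ^ p / a| < 1 →
      Summable (upperTerm n a b p) ∧
      catalanFunctional n a b p =
        1 / (a * b ^ n * (n.factorial : ℝ)) * ∑' k : ℕ, upperTerm n a b p k) ∧
    -- lower signs, summation from `k = 0`, for `n ≥ 1`
    (∀ a b : ℝ, 0 < a → 0 < b → 1 < |b ^ p / a| → 1 ≤ n →
      Summable (lowerTerm n a b p) ∧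
      catalanFunctional n a b p =
        -(1 / (a * b ^ n * (n.factorial : ℝ))) * ∑' k : ℕ, lowerTerm n a b p k) ∧
    -- lower signs, the term `k = 0` omitted, for every `n ≥ 0`
    (∀ a b : ℝ, 0 < a → 0 < b → 1 < |b ^ p / a| →
      Summable (fun k : ℕ => lowerTerm n a b p (k + 1)) ∧
      catalanFunctional n a b p =
        -(1 / (a * b ^ n * (n.factorial : ℝ))) * ∑' k : ℕ, lowerTerm n a b p (k + 1)) ∧
    -- `a = 0`: the lower formula after cancelling the factor `1 / a`
    (∀ b : ℝ, 0 < b →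
      catalanFunctional n 0 b p =
        risingFactorial p n / ((n.factorial : ℝ) * b ^ ((n : ℝ) + p))) ∧
    -- the boundary case `a = b ^ p` is the limit of both formulas
    (∀ b : ℝ, 0 < b →
      Tendsto
        (fun q : ℝ × ℝ =>
          1 / (q.1 * q.2 ^ n * (n.factorial : ℝ)) * ∑' k : ℕ, upperTerm n q.1 q.2 p k)
        (𝓝[{q : ℝ × ℝ | 0 < q.1 ∧ 0 < q.2 ∧ |q.2 ^ p / q.1| < 1}] (b ^ p, b))
        (𝓝 (catalanFunctional n (b ^ p) b p)) ∧
      Tendsto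
        (fun q : ℝ × ℝ =>
          -(1 / (q.1 * q.2 ^ n * (n.factorial : ℝ))) *
            ∑' k : ℕ, lowerTerm n q.1 q.2 p (k + 1))
        (𝓝[{q : ℝ × ℝ | 0 < q.1 ∧ 0 < q.2 ∧ 1 < |q.2 ^ p / q.1|}] (b ^ p, b))
        (𝓝 (catalanFunctional n (b ^ p) b p))) ∧
    -- `n = 0`
    (∀ a b : ℝ, 0 ≤ a → 0 < b → catalanFunctional 0 a b p = 1 / (a + b ^ p)) ∧
    (∀ b : ℝ, 0 < b → catalanFunctional 0 (b ^ p) b p = 1 / (2 * b ^ p)) := by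
  refine ⟨fun a b _ hb ↦ integrableOn_catalanIntegrand hp0 hp1 n a hb,
    fun a b ha hb hab ↦ ⟨summable_upperTerm n hab,
      catalanFunctional_eq_tsum_upperTerm hp0 hp1 n ha hb hab⟩,
    fun a b ha hb hab hn ↦ ⟨summable_lowerTerm n hab,
      catalanFunctional_eq_tsum_lowerTerm hp0 hp1 (Nat.one_le_iff_ne_zero.1 hn) ha hb hab⟩,
    fun a b ha hb hab ↦ ⟨(summable_nat_add_iff 1).2 (summable_lowerTerm n hab),
      catalanFunctional_eq_tsum_lowerTerm_add_one hp0 hp1 n ha hb hab⟩,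
    fun b hb ↦ catalanFunctional_zero_eq_risingFactorial_div hp0 hp1 n hb,
    fun b hb ↦ ?boundary,
    fun a b ha hb ↦ catalanFunctional_zero hp0 hp1 ha hb,
    fun b hb ↦ by rw [catalanFunctional_zero hp0 hp1 (Real.rpow_nonneg hb.le p) hb, two_mul]⟩
  case boundary =>
    have hcont := continuousAt_catalanFunctional hp0 hp1 n (b ^ p) hb
    exact ⟨tendsto_nhdsWithin_congr
        (fun q hq ↦ catalanFunctional_eq_tsum_upperTerm hp0 hp1 n hq.1 hq.2.1 hq.2.2)
        hcont.continuousWithinAt,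
      tendsto_nhdsWithin_congr
        (fun q hq ↦ catalanFunctional_eq_tsum_lowerTerm_add_one hp0 hp1 n hq.1 hq.2.1 hq.2.2)
        hcont.continuousWithinAt⟩
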